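/- A proper Helly circular-arc graph is the intersection graph of a finite family of arcs on a circle such that no arc properly contains another and every set of pairwise intersecting arcs has a common point. An instance $(G,k)$ of PHCAVD consists of a finite simple graph $G$ and an integer $k\ge 0$; it is a yes-instance if there is $X\subseteq V(G)$ with $|X|\le k$ such that $G-X$ is a proper Helly circular-arc graph. A $t$-solution is a set $X \subseteq V(G)$ with $|X|\le t$ such that $G-X$ is a proper Helly circular-arc graph. A family $\mathcal W\subseteq 2^{V(G)}$ is $t$-necessary if every $t$-solution intersects every member of $\mathcal W$. A large obstruction of $G$ is an induced subgraph $\mathbb O$ with at least $12$ vertices that is not a proper Helly circular-arc graph, while $\mathbb O-v$ is one for every $v\in V(\mathbb O)$. For a constant $c$, a set $T\subseteq V(G)$ is a nice modulator for $(G,k)$ of size at most $c\cdot\max\{k,1\}^{12}$ if $|T|\le c\cdot\max\{k,1\}^{12}$, the graph $G-T$ is a proper Helly circular-arc graph, and there is a $(k+2)$-necessary family $\mathcal W\subseteq 2^{T}$ such that $|V(\mathbb O)\cap T|\ge 6$ for every large obstruction $\mathbb O$ whose vertex set contains no member of $\mathcal W$. **Lemma.** For every constant $c$ there are a constant $C$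 and a polynomial-time algorithm that does the following. Given an instance $(G,k)$ of PHCAVD and a nice modulator $T\subseteq V(G)$ for $(G,k)$ of size at most $c\cdot\max\{k,1\}^{12}$, it constructs an instance $(G',k')$, where $G'$ is an induced subgraph of $G$ and $k'\le k$, such that $(G',k')$ is a yes-instance if and only if $(G,k)$ is a yes-instance, and $G'-T$ (the graph obtained from $G'$ by deleting the vertices of $T$ that lie in $G'$) has at most $C\cdot\max\{k,1\}\cdot|T|^2$ connected components. The running time is bounded by a polynomial in the number of vertices of $G$ and the number of binary digits of $k$. -/

import Mathlib

namespace PHCAVD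

/-! ### Proper Helly circular-arc graphs -/

/-- The closed arc on the circle `ℝ / ℤ` that is traversed from `a` to `b`. -/
def arc (a b : ℝ) : Set UnitAddCircle :=
  (fun t : ℝ => (t : UnitAddCircle)) '' Set.Icc a b

/-- `G` is the intersection graph of a family of arcs on a circle (vertex `v` gets the arc from
`a v` to `b v`, which is neither a point nor the whole circle), such that no arc properly contains
another one, and every set of pairwise intersecting arcs has a common point. -/
def IsProperHellyCircularArc {V : Type*} (G : SimpleGraph V) : Prop :=
  ∃ a b : V → ℝ,
    (∀ v, a v < b v ∧ b v < a v + 1) ∧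
    (∀ u v, u ≠ v → (G.Adj u v ↔ (arc (a u) (b u) ∩ arc (a v) (b v)).Nonempty)) ∧
    (∀ u v, ¬ arc (a u) (b u) ⊂ arc (a v) (b v)) ∧
    (∀ S : Set V,
      (∀ u ∈ S, ∀ v ∈ S, (arc (a u) (b u) ∩ arc (a v) (b v)).Nonempty) →
      (⋂ v ∈ S, arc (a v) (b v)).Nonempty)

/-! ### The deletion problem, obstructions and nice modulators -/

/-- `X` is a `t`-solution: it has at most `t` vertices, and `G - X` is a proper Helly
circular-arc graph. -/
def IsSolution {V : Type*} (G : SimpleGraph V) (t : ℕ) (X : Finset V) : Prop :=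
  X.card ≤ t ∧ IsProperHellyCircularArc (G.induce {v | v ∉ X})

/-- `(G, k)` is a yes-instance of Proper Helly Circular-arc Vertex Deletion. -/
def IsYesInstance {V : Type*} (G : SimpleGraph V) (k : ℕ) : Prop :=
  ∃ X : Finset V, IsSolution G k X

/-- `O` is the vertex set of an obstruction in `G`: the subgraph induced by `O` is not a proper
Helly circular-arc graph, but it becomes one when any single vertex is deleted. -/
def IsObstruction {V : Type*} (G : SimpleGraph V) (O : Finset V) : Prop :=
  ¬ IsProperHellyCircularArc (G.induce {v | v ∈ O}) ∧
    ∀ w ∈ O, IsProperHellyCircularArc (G.induce {v | v ∈ O ∧ v ≠ w})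

/-- Large obstructions are those with at least 12 vertices. -/
def IsLargeObstruction {V : Type*} (G : SimpleGraph V) (O : Finset V) : Prop :=
  IsObstruction G O ∧ 12 ≤ O.card

/-- The family `W` of vertex sets is `t`-necessary: every `t`-solution hits every member. -/
def IsNecessary {V : Type*} (G : SimpleGraph V) (t : ℕ) (W : Set (Finset V)) : Prop :=
  ∀ X : Finset V, IsSolution G t X → ∀ A ∈ W, ∃ v ∈ A, v ∈ X

/-- `T` is a nice modulator for the instance `(G, k)`, with the constant `c` in its size bound
`|T| = O(k ^ 12)`. -/
def IsNiceModulator {V : Type*} [DecidableEq V] (c : ℕ) (G : SimpleGraph V) (k : ℕ)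
    (T : Finset V) : Prop :=
  IsProperHellyCircularArc (G.induce {v | v ∉ T}) ∧
  T.card ≤ c * (max k 1) ^ 12 ∧
  ∃ W : Set (Finset V),
    (∀ A ∈ W, A ⊆ T) ∧
    IsNecessary G (k + 2) W ∧
    ∀ O : Finset V, IsLargeObstruction G O → (∀ A ∈ W, ¬ A ⊆ O) → 6 ≤ (O ∩ T).card

/-! ### Random-access programs and their running time

Programs are while-programs on a random-access memory.  The memory has registers and
two-dimensional arrays, whose cells hold natural numbers.  The only arithmetic operations are
addition and truncated subtraction, so that in `t` steps numbers get at most `O(t)` bits longer,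
and polynomial time means the same as on Turing machines. -/

/-- A memory state: the registers `reg x`, and the cells `arr a i j` of the arrays. -/
structure Memory where
  reg : ℕ → ℕ
  arr : ℕ → ℕ → ℕ → ℕ

/-- Arithmetic expressions; `get a e f` reads the cell of array `a` with the indices `e`, `f`. -/
inductive Expr where
  | const (m : ℕ) : Expr
  | reg (x : ℕ) : Expr
  | get (a : ℕ) (e f : Expr) : Expr
  | add (e f : Expr) : Expr
  | sub (e f : Expr) : Expr

/-- The value of an expression; subtraction is truncated at zero. -/
def Expr.eval (s : Memory) : Expr → ℕ
  | .const m => m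
  | .reg x => s.reg x
  | .get a e f => s.arr a (e.eval s) (f.eval s)
  | .add e f => e.eval s + f.eval s
  | .sub e f => e.eval s - f.eval s

/-- The number of steps for evaluating an expression: one for each constant, read or operation. -/
def Expr.cost : Expr → ℕ
  | .const _ => 1
  | .reg _ => 1
  | .get _ e f => e.cost + f.cost + 1
  | .add e f => e.cost + f.cost + 1
  | .sub e f => e.cost + f.cost + 1

/-- Programs; a condition `e` counts as true when its value is not zero. -/
inductive Program where
  | skip : Program
  | assign (x : ℕ) (e : Expr) : Program
  | store (a : ℕ) (i j e : Expr) : Program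
  | seq (p q : Program) : Program
  | cond (e : Expr) (p q : Program) : Program
  | loop (e : Expr) (p : Program) : Program

/-- The memory after writing `m` to register `x`. -/
def Memory.setReg (s : Memory) (x m : ℕ) : Memory :=
  { s with reg := fun y => if y = x then m else s.reg y }

/-- The memory after writing `m` to the cell `(i, j)` of array `a`. -/
def Memory.setArr (s : Memory) (a i j m : ℕ) : Memory :=
  { s with arr := fun a' i' j' => if a' = a ∧ i' = i ∧ j' = j then m else s.arr a' i' j' }

/-- `Runs p s t s'`: started in memory `s`, the program `p` halts after exactly `t` steps
in memory `s'`. -/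
inductive Runs : Program → Memory → ℕ → Memory → Prop
  | skip (s : Memory) : Runs .skip s 1 s
  | assign (s : Memory) (x : ℕ) (e : Expr) :
      Runs (.assign x e) s (e.cost + 1) (s.setReg x (e.eval s))
  | store (s : Memory) (a : ℕ) (i j e : Expr) :
      Runs (.store a i j e) s (i.cost + j.cost + e.cost + 1)
        (s.setArr a (i.eval s) (j.eval s) (e.eval s))
  | seq {p q : Program} {s s' s'' : Memory} {t t' : ℕ} :
      Runs p s t s' → Runs q s' t' s'' → Runs (.seq p q) s (t + t') s''
  | cond_true {e : Expr} {p q : Program} {s s' : Memory} {t : ℕ} :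
      e.eval s ≠ 0 → Runs p s t s' → Runs (.cond e p q) s (e.cost + 1 + t) s'
  | cond_false {e : Expr} {p q : Program} {s s' : Memory} {t : ℕ} :
      e.eval s = 0 → Runs q s t s' → Runs (.cond e p q) s (e.cost + 1 + t) s'
  | loop_done {e : Expr} {p : Program} {s : Memory} :
      e.eval s = 0 → Runs (.loop e p) s (e.cost + 1) s
  | loop_step {e : Expr} {p : Program} {s s' s'' : Memory} {t t' : ℕ} :
      e.eval s ≠ 0 → Runs p s t s' → Runs (.loop e p) s' t' s'' →
      Runs (.loop e p) s (e.cost + 1 + t + t') s''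

/-! ### Instances in memory

Graphs have their vertices among the labels `0, …, n - 1`. -/

open Classical in
/-- The indicator of a set `S` of labels. -/
noncomputable def vertexCell {n : ℕ} (S : Finset (Fin n)) (i : ℕ) : ℕ :=
  if ∃ v ∈ S, (v : ℕ) = i then 1 else 0

open Classical in
/-- The adjacency matrix of the subgraph of `G` induced by `S`. -/
noncomputable def adjCell {n : ℕ} (G : SimpleGraph (Fin n)) (S : Finset (Fin n)) (i j : ℕ) : ℕ :=
  if ∃ u ∈ S, ∃ v ∈ S, (u : ℕ) = i ∧ (v : ℕ) = j ∧ G.Adj u v then 1 else 0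

/-- The memory contains the instance `(G[S], k)`: register 0 holds the number `n` of labels,
register 1 holds `k`, array 0 the adjacency matrix and array 1 (column 0) the vertex set. -/
def HoldsInstance {n : ℕ} (s : Memory) (G : SimpleGraph (Fin n)) (S : Finset (Fin n))
    (k : ℕ) : Prop :=
  s.reg 0 = n ∧ s.reg 1 = k ∧ (∀ i j, s.arr 0 i j = adjCell G S i j) ∧
    ∀ i, s.arr 1 i 0 = vertexCell S i

/-- The initial memory for the instance `(G, k)` with vertex set `T`, where `T` is given in
array 2 (column 0), and all the unused registers and cells are zero. -/
noncomputable def inputMemory {n : ℕ} (G : SimpleGraph (Fin n)) (k : ℕ) (T : Finset (Fin n)) :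
    Memory where
  reg := fun x => if x = 0 then n else if x = 1 then k else 0
  arr := fun a i j =>
    if a = 0 then adjCell G Finset.univ i j
    else if a = 1 ∧ j = 0 then vertexCell (Finset.univ : Finset (Fin n)) i
    else if a = 2 ∧ j = 0 then vertexCell T i
    else 0

/-- The number of connected components of a graph. -/
noncomputable def numComponents {V : Type*} (G : SimpleGraph V) : ℕ :=
  Nat.card G.ConnectedComponent

end PHCAVD

namespace PHCAVD

/-! ### Arcs and intervals -/

/-! The kernel keeps `k` and `T`. For each vertex of `T` in turn it marks up to `k + 3` unmarked
components of `G - T` that the vertex sees, giving `M₀`; then it marks up to `k + 3` further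
components, giving `M`, and deletes all unmarked components. This leaves at most `(|T| + 1) * (k +
3)` components. If `T` is empty, `G` is itself in the class and everything is deleted.

The class is hereditary, so only lifting a solution `X` of the kernel to `G` needs an argument
(`isYesInstance_induce_iff`). It rests on two facts: the class is claw-free, and a disconnected
member is a proper interval graph, because the circle can be cut at a point of an arc from another
component.

A vertex of `T` outside `X` that sees a component outside `M₀` has `k + 3` marked components in its
neighbourhood; `X` misses three of them, which yields a claw. So every surviving vertex of `T` sees
only components in `M₀`. If all components are marked, nothing was deleted. Otherwise `M` contains
`k + 3` components outside `M₀`, and `X` misses two of them. Hence the kernel minus `X` is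
disconnected, as is `G - T`, so both are proper interval graphs. The deleted components have no edge
to the surviving kernel, and a disjoint union of proper interval graphs is again one, hence in the
class.

The program computes components by repeated relabelling. All its loops have length `n`, and `k` is
only compared with a counter, so `O(n ^ 3)` steps suffice. -/

theorem coe_unitAddCircle_eq_iff (s t : ℝ) :
    (s : UnitAddCircle) = t ↔ ∃ m : ℤ, s = t + m := by
  rw [← sub_eq_zero, ← AddCircle.coe_sub, AddCircle.coe_eq_zero_iff]
  constructor
  · rintro ⟨m, hm⟩
    exact ⟨m, by simp at hm; linarith⟩
  · rintro ⟨m, hm⟩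
    exact ⟨m, by simp; linarith⟩

theorem coe_mem_arc_iff {a b t : ℝ} :
    (t : UnitAddCircle) ∈ arc a b ↔ ∃ m : ℤ, a ≤ t + m ∧ t + m ≤ b := by
  constructor
  · rintro ⟨s, ⟨h1, h2⟩, hs⟩
    obtain ⟨m, hm⟩ := (coe_unitAddCircle_eq_iff s t).1 hs
    exact ⟨m, hm ▸ h1, hm ▸ h2⟩
  · rintro ⟨m, h1, h2⟩
    exact ⟨t + m, ⟨h1, h2⟩, (coe_unitAddCircle_eq_iff _ _).2 ⟨m, rfl⟩⟩

theorem arc_inter_nonempty_iff {a b c d : ℝ} (hab : a ≤ b) (hcd : c ≤ d) :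
    (arc a b ∩ arc c d).Nonempty ↔ ∃ m : ℤ, a ≤ d + m ∧ c + m ≤ b := by
  constructor
  · rintro ⟨_, ⟨s, ⟨h1, h2⟩, rfl⟩, hs⟩
    obtain ⟨m, h3, h4⟩ := coe_mem_arc_iff.1 hs
    exact ⟨-m, by push_cast; linarith, by push_cast; linarith⟩
  · rintro ⟨m, h1, h2⟩
    -- The larger left end of two meeting intervals lies in both.
    refine ⟨((max a (c + m) : ℝ) : UnitAddCircle),
      coe_mem_arc_iff.2 ⟨0, ?_, ?_⟩, coe_mem_arc_iff.2 ⟨-m, ?_, ?_⟩⟩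
    · simp
    · simp [hab, h2]
    · push_cast; linarith [le_max_right a (c + m)]
    · push_cast
      linarith [max_le h1 (by linarith : c + m ≤ d + (m : ℝ))]

theorem arc_add_int (a b : ℝ) (m : ℤ) : arc (a + m) (b + m) = arc a b := by
  ext p
  obtain ⟨t, rfl⟩ := QuotientAddGroup.mk_surjective p
  change (t : UnitAddCircle) ∈ _ ↔ (t : UnitAddCircle) ∈ _
  rw [coe_mem_arc_iff, coe_mem_arc_iff]
  constructor
  · rintro ⟨l, h1, h2⟩
    exact ⟨l - m, by push_cast; linarith, by push_cast; linarith⟩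
  · rintro ⟨l, h1, h2⟩
    exact ⟨l + m, by push_cast; linarith, by push_cast; linarith⟩

theorem int_eq_zero_of_lt {m : ℤ} (h1 : (-1 : ℝ) < m) (h2 : (m : ℝ) < 1) : m = 0 := by
  have h1' : (-1 : ℤ) < m := by exact_mod_cast h1
  have h2' : m < 1 := by exact_mod_cast h2
  omega

/-- Inside an open unit interval, arcs behave as intervals. -/
theorem coe_mem_arc_iff_of_lt {q a b t : ℝ} (ha : q < a) (hb : b < q + 1)
    (h1 : q < t) (h2 : t < q + 1) : (t : UnitAddCircle) ∈ arc a b ↔ a ≤ t ∧ t ≤ b := by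
  rw [coe_mem_arc_iff]
  constructor
  · rintro ⟨m, h3, h4⟩
    obtain rfl : m = 0 := int_eq_zero_of_lt (by linarith) (by linarith)
    simpa using And.intro h3 h4
  · rintro ⟨h3, h4⟩
    exact ⟨0, by simpa using h3, by simpa using h4⟩

theorem arc_inter_nonempty_iff_of_lt {q a b c d : ℝ} (hab : a ≤ b) (hcd : c ≤ d)
    (ha : q < a) (hb : b < q + 1) (hc : q < c) (hd : d < q + 1) :
    (arc a b ∩ arc c d).Nonempty ↔ a ≤ d ∧ c ≤ b := by
  rw [arc_inter_nonempty_iff hab hcd]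
  constructor
  · rintro ⟨m, h3, h4⟩
    obtain rfl : m = 0 := int_eq_zero_of_lt (by linarith) (by linarith)
    simpa using And.intro h3 h4
  · rintro ⟨h3, h4⟩
    exact ⟨0, by simpa using h3, by simpa using h4⟩

/-- An arc that meets another one without being contained in it contains one of its ends. -/
theorem end_mem_arc_of_not_subset {a b c d : ℝ}
    (h : (arc c d ∩ arc a b).Nonempty) (hn : ¬ arc c d ⊆ arc a b) :
    (a : UnitAddCircle) ∈ arc c d ∨ (b : UnitAddCircle) ∈ arc c d := by
  obtain ⟨_, ⟨s, ⟨h1, h2⟩, rfl⟩, hs⟩ := h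
  obtain ⟨m, h3, h4⟩ := coe_mem_arc_iff.1 hs
  by_contra hcon
  simp only [not_or, coe_mem_arc_iff, not_exists, not_and] at hcon
  obtain ⟨h5, h6⟩ := hcon
  -- If no lift of `[c, d]` contains `a` or `b`, the lift meeting `[a, b]` cannot leave it.
  refine hn ?_
  rintro _ ⟨r, ⟨h7, h8⟩, rfl⟩
  have h9 := h5 (-m)
  have h10 := h6 (-m)
  push_cast at h9 h10
  refine coe_mem_arc_iff.2 ⟨m, ?_, ?_⟩
  · by_contra hc
    exact h9 (by linarith) (by linarith)
  · by_contra hc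
    exact h10 (by linarith) (by linarith)

/-! ### Proper Helly circular-arc graphs and proper interval graphs -/

theorem IsProperHellyCircularArc.of_embedding {V W : Type*} {G : SimpleGraph V}
    {H : SimpleGraph W} (h : IsProperHellyCircularArc G) (f : H ↪g G) :
    IsProperHellyCircularArc H := by
  obtain ⟨a, b, h1, h2, h3, h4⟩ := h
  refine ⟨a ∘ f, b ∘ f, fun v => h1 _, fun u v huv => ?_, fun u v => h3 _ _, fun S hS => ?_⟩
  · rw [← f.map_adj_iff]
    exact h2 _ _ (f.injective.ne huv)
  · have := h4 (f '' S) (by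
      rintro _ ⟨u, hu, rfl⟩ _ ⟨v, hv, rfl⟩
      exact hS u hu v hv)
    simpa using this

/-- The arc of each leaf contains an end of the arc of the centre. There are three leaves and two
ends, so two leaves meet. -/
theorem IsProperHellyCircularArc.claw_free {V : Type*} {G : SimpleGraph V}
    (h : IsProperHellyCircularArc G) (v : V) (x : Fin 3 → V) (hx : Function.Injective x)
    (hv : ∀ i, G.Adj v (x i)) (hn : ∀ i j, ¬ G.Adj (x i) (x j)) : False := by
  obtain ⟨a, b, h1, h2, h3, -⟩ := h
  have hmeet (i) : (arc (a (x i)) (b (x i)) ∩ arc (a v) (b v)).Nonempty :=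
    (h2 _ _ (hv i).symm.ne).1 (hv i).symm
  have hdisj (i j) (hij : i ≠ j) (p) (hi : p ∈ arc (a (x i)) (b (x i)))
      (hj : p ∈ arc (a (x j)) (b (x j))) : False :=
    hn i j ((h2 _ _ (hx.ne hij)).2 ⟨p, hi, hj⟩)
  -- By properness, containment would be equality, and then every other leaf would meet leaf `i`.
  have hsub (i) : ¬ arc (a (x i)) (b (x i)) ⊆ arc (a v) (b v) := by
    intro hs
    have heq : arc (a (x i)) (b (x i)) = arc (a v) (b v) := by
      by_contra hne
      exact h3 _ _ (hs.ssubset_of_ne hne)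
    obtain ⟨j, hij⟩ : ∃ j : Fin 3, i ≠ j := ⟨i + 1, by fin_cases i <;> decide⟩
    obtain ⟨p, hp1, hp2⟩ := hmeet j
    exact hdisj i j hij p (heq ▸ hp2) hp1
  have key (i) := end_mem_arc_of_not_subset (hmeet i) (hsub i)
  rcases key 0 with h0 | h0 <;> rcases key 1 with h1 | h1 <;> rcases key 2 with h2 | h2 <;>
  first
  | exact hdisj 0 1 (by decide) _ h0 h1
  | exact hdisj 0 2 (by decide) _ h0 h2
  | exact hdisj 1 2 (by decide) _ h1 h2

/-- `G` is the intersection graph of intervals on the line, none of which properly contains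
another one. -/
def IsProperInterval {V : Type*} (G : SimpleGraph V) : Prop :=
  ∃ a b : V → ℝ, (∀ v, a v < b v) ∧
    (∀ u v, u ≠ v → (G.Adj u v ↔ a u ≤ b v ∧ a v ≤ b u)) ∧
    ∀ u v, a u < a v ↔ b u < b v

theorem IsProperInterval.of_embedding {V W : Type*} {G : SimpleGraph V}
    {H : SimpleGraph W} (h : IsProperInterval G) (f : H ↪g G) : IsProperInterval H := by
  obtain ⟨a, b, h1, h2, h3⟩ := h
  refine ⟨a ∘ f, b ∘ f, fun v => h1 _, fun u v huv => ?_, fun u v => h3 _ _⟩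
  rw [← f.map_adj_iff]
  exact h2 _ _ (f.injective.ne huv)

/-- The intervals of a proper interval graph can be squeezed into the open unit interval. -/
theorem IsProperInterval.exists_unit {V : Type*} {G : SimpleGraph V} (h : IsProperInterval G) :
    ∃ a b : V → ℝ, (∀ v, 0 < a v ∧ a v < b v ∧ b v < 1) ∧
      (∀ u v, u ≠ v → (G.Adj u v ↔ a u ≤ b v ∧ a v ≤ b u)) ∧
      ∀ u v, a u < a v ↔ b u < b v := by
  obtain ⟨a, b, h1, h2, h3⟩ := h
  have hs := Real.sigmoid_strictMono
  refine ⟨fun v => Real.sigmoid (a v), fun v => Real.sigmoid (b v), fun v =>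
    ⟨Real.sigmoid_pos _, hs (h1 v), Real.sigmoid_lt_one _⟩, fun u v huv => ?_, fun u v => ?_⟩
  · simpa only [hs.le_iff_le] using h2 u v huv
  · simpa only [hs.lt_iff_lt] using h3 u v

/-- Inside an open unit interval arcs meet and contain each other exactly as intervals do, and
intervals on a line have the Helly property. -/
theorem IsProperInterval.isProperHellyCircularArc {V : Type*} {G : SimpleGraph V}
    (h : IsProperInterval G) : IsProperHellyCircularArc G := by
  obtain ⟨a, b, h1, h2, h3⟩ := h.exists_unit
  have hinter (u v) : (arc (a u) (b u) ∩ arc (a v) (b v)).Nonempty ↔ a u ≤ b v ∧ a v ≤ b u :=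
    arc_inter_nonempty_iff_of_lt (q := 0) (h1 u).2.1.le (h1 v).2.1.le (h1 u).1
      (by linarith [(h1 u).2.2]) (h1 v).1 (by linarith [(h1 v).2.2])
  refine ⟨a, b, fun v => ⟨(h1 v).2.1, by linarith [(h1 v).1, (h1 v).2.2]⟩,
    fun u v huv => by rw [hinter, h2 u v huv], fun u v huv => ?_, fun S hS => ?_⟩
  · obtain ⟨u1, u2, u3⟩ := h1 u
    obtain ⟨v1, v2, v3⟩ := h1 v
    have ha := (coe_mem_arc_iff_of_lt (q := 0) v1 (by linarith) u1 (by linarith)).1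
      (huv.1 (coe_mem_arc_iff.2 ⟨0, by simp, by simpa using u2.le⟩))
    have hb := (coe_mem_arc_iff_of_lt (q := 0) v1 (by linarith) (u1.trans u2) (by linarith)).1
      (huv.1 (coe_mem_arc_iff.2 ⟨0, by simpa using u2.le, by simp⟩))
    have e1 : b u = b v := le_antisymm hb.2 (not_lt.1 fun hlt => by linarith [(h3 u v).2 hlt])
    have e2 : a u = a v := le_antisymm (not_lt.1 fun hlt => by linarith [(h3 v u).1 hlt]) ha.1
    exact huv.ne (by rw [e1, e2])
  · rcases S.eq_empty_or_nonempty with rfl | ⟨v₀, hv₀⟩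
    · simp
    -- The supremum of the left ends exceeds no right end; it exists even for infinite `S` as all
    -- ends are below 1.
    · refine ⟨((sSup (a '' S) : ℝ) : UnitAddCircle), ?_⟩
      simp only [Set.mem_iInter]
      refine fun v hv => coe_mem_arc_iff.2 ⟨0, ?_, ?_⟩
      · simpa using le_csSup ⟨1, by
          rintro _ ⟨u, -, rfl⟩
          linarith [h1 u]⟩ (Set.mem_image_of_mem a hv)
      · simpa using csSup_le (Set.Nonempty.image a ⟨v₀, hv₀⟩) (by
          rintro _ ⟨u, hu, rfl⟩
          exact ((hinter u v).1 (hS u hu v hv)).1)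

/-- The two models are squeezed into `(0, 1)` and `(2, 3)`, so that they do not interact. -/
theorem IsProperInterval.of_split {V : Type*} {G : SimpleGraph V} (s : Set V)
    (h₁ : IsProperInterval (G.induce s)) (h₂ : IsProperInterval (G.induce sᶜ))
    (h : ∀ x ∈ s, ∀ y ∉ s, ¬ G.Adj x y) : IsProperInterval G := by
  classical
  obtain ⟨a, b, a1, a2, a3⟩ := h₁.exists_unit
  obtain ⟨c, d, c1, c2, c3⟩ := h₂.exists_unit
  refine ⟨fun v => if hv : v ∈ s then a ⟨v, hv⟩ else c ⟨v, hv⟩ + 2,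
    fun v => if hv : v ∈ s then b ⟨v, hv⟩ else d ⟨v, hv⟩ + 2, fun v => ?_, fun u v huv => ?_,
    fun u v => ?_⟩
  · by_cases hv : v ∈ s
    · simpa [hv] using (a1 ⟨v, hv⟩).2.1
    · simpa [hv] using (c1 ⟨v, hv⟩).2.1
  · by_cases hu : u ∈ s <;> by_cases hv : v ∈ s
    · simpa [hu, hv] using a2 ⟨u, hu⟩ ⟨v, hv⟩ (by simpa using huv)
    · have := a1 ⟨u, hu⟩
      have := c1 ⟨v, hv⟩
      simp only [hu, hv, h u hu v hv, dite_true, dite_false, false_iff]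
      rintro ⟨h1, h2⟩
      linarith
    · have := c1 ⟨u, hu⟩
      have := a1 ⟨v, hv⟩
      have hn : ¬ G.Adj u v := fun h' => h v hv u hu h'.symm
      simp only [hu, hv, hn, dite_true, dite_false, false_iff]
      rintro ⟨h1, h2⟩
      linarith
    · simpa [hu, hv] using c2 ⟨u, hu⟩ ⟨v, hv⟩ (by simpa using huv)
  · by_cases hu : u ∈ s <;> by_cases hv : v ∈ s
    · simpa [hu, hv] using a3 ⟨u, hu⟩ ⟨v, hv⟩
    · have := a1 ⟨u, hu⟩
      have := c1 ⟨v, hv⟩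
      simp only [hu, hv, dite_true, dite_false]
      exact iff_of_true (by linarith) (by linarith)
    · have := c1 ⟨u, hu⟩
      have := a1 ⟨v, hv⟩
      simp only [hu, hv, dite_true, dite_false]
      exact iff_of_false (by linarith) (by linarith)
    · simpa [hu, hv] using c3 ⟨u, hu⟩ ⟨v, hv⟩

/-- The vertices of a proper Helly circular-arc graph that have no neighbour outside `s` induce
a proper interval graph if there is a vertex outside `s`. -/
theorem IsProperHellyCircularArc.isProperInterval_induce {V : Type*} {G : SimpleGraph V}
    (h : IsProperHellyCircularArc G) (s : Set V) (w : V) (hw : w ∉ s)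
    (hs : ∀ x ∈ s, ¬ G.Adj x w) : IsProperInterval (G.induce s) := by
  obtain ⟨a, b, h1, h2, h3, -⟩ := h
  -- The circle is cut at `q`: it lies on the arc of `w`, hence on no arc of `s`.
  set q := a w with hq
  have hmiss (v : s) : (q : UnitAddCircle) ∉ arc (a v) (b v) := fun hmem =>
    hs v v.2 ((h2 _ _ (ne_of_mem_of_not_mem v.2 hw)).2
      ⟨q, hmem, coe_mem_arc_iff.2 ⟨0, by simp [hq], by simpa [hq] using (h1 w).1.le⟩⟩)
  -- This shift moves the left end into `[q, q + 1)`; missing `q` then confines the whole interval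
  -- to `(q, q + 1)`.
  let m (v : s) : ℤ := -⌊a v - q⌋
  have harc (v : s) : arc (a v + m v) (b v + m v) = arc (a v) (b v) := arc_add_int _ _ _
  have hlow (v : s) : q < a v + m v := by
    refine lt_of_le_of_ne ?_ fun e => ?_
    · have := Int.floor_le (a v - q)
      simp only [m]; push_cast; linarith
    · refine hmiss v ?_
      rw [← harc v, e]
      exact coe_mem_arc_iff.2 ⟨0, by simp, by simpa using (h1 v).1.le⟩
  have hup (v : s) : b v + m v < q + 1 := by
    by_contra hcon
    refine hmiss v ?_
    rw [← harc v]
    refine coe_mem_arc_iff.2 ⟨1, ?_, ?_⟩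
    · have := Int.lt_floor_add_one (a v - q)
      simp only [m]; push_cast; linarith
    · push_cast; linarith
  have hlt (v : s) : a v + m v < b v + m v := by linarith [(h1 v).1]
  -- Nested intervals give nested arcs, which coincide by properness; inside the cut circle the ends
  -- are then equal.
  have hcont (u v : s) (ha : a v + m v ≤ a u + m u) (hb : b u + m u ≤ b v + m v) :
      a v + m v = a u + m u ∧ b u + m u = b v + m v := by
    have hsub : arc (a u) (b u) ⊆ arc (a v) (b v) := by
      rw [← harc u, ← harc v]
      exact Set.image_mono (Set.Icc_subset_Icc ha hb)
    have heq : arc (a v + m v) (b v + m v) = arc (a u + m u) (b u + m u) := by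
      rw [harc, harc]
      by_contra hne
      exact h3 _ _ (hsub.ssubset_of_ne (Ne.symm hne))
    have e1 := (coe_mem_arc_iff_of_lt (hlow u) (hup u) (hlow v) ((hlt v).trans (hup v))).1
      (heq ▸ coe_mem_arc_iff.2 ⟨0, by simp, by simpa using (h1 v).1.le⟩)
    have e2 := (coe_mem_arc_iff_of_lt (hlow u) (hup u) ((hlow v).trans (hlt v)) (hup v)).1
      (heq ▸ coe_mem_arc_iff.2 ⟨0, by simpa using (h1 v).1.le, by simp⟩)
    exact ⟨le_antisymm ha e1.1, le_antisymm hb e2.2⟩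
  refine ⟨fun v => a v + m v, fun v => b v + m v, hlt, fun u v huv => ?_, fun u v => ?_⟩
  · rw [← arc_inter_nonempty_iff_of_lt (hlt u).le (hlt v).le (hlow u) (hup u) (hlow v) (hup v),
      harc, harc]
    exact h2 u v (by simpa [Subtype.ext_iff] using huv)
  · constructor
    · intro hlt'
      by_contra hcon
      exact hlt'.ne (hcont v u hlt'.le (not_lt.1 hcon)).1
    · intro hlt'
      by_contra hcon
      exact hlt'.ne (hcont u v (not_lt.1 hcon) hlt'.le).2

/-- A disconnected proper Helly circular-arc graph is a proper interval graph. -/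
theorem IsProperHellyCircularArc.isProperInterval {V : Type*} {G : SimpleGraph V}
    (h : IsProperHellyCircularArc G) (s : Set V) (x y : V) (hx : x ∈ s) (hy : y ∉ s)
    (hs : ∀ x ∈ s, ∀ y ∉ s, ¬ G.Adj x y) : IsProperInterval G :=
  .of_split s (h.isProperInterval_induce s y hy fun v hv => hs v hv y hy)
    (h.isProperInterval_induce sᶜ x (by simpa using hx) fun v hv h' => hs x hx v hv h'.symm) hs

/-! ### Reducing the number of components -/

/-- Either all labels of vertices with the property `N` are in `M`, or `M` has at least `K` such
labels that are not in `M₀`. -/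
def Saturated {V : Type*} (L : V → ℕ) (N : V → Prop) (K : ℕ) (M₀ M : Finset ℕ) : Prop :=
  (∀ u, N u → L u ∈ M) ∨
    ∃ Q ⊆ M, Disjoint Q M₀ ∧ K ≤ Q.card ∧ ∀ l ∈ Q, ∃ u, N u ∧ L u = l

theorem Saturated.mono {V : Type*} {L : V → ℕ} {N : V → Prop} {K : ℕ} {M₀ M M' : Finset ℕ}
    (h : Saturated L N K M₀ M) (hM : M ⊆ M') : Saturated L N K M₀ M' := by
  rcases h with h | ⟨Q, h1, h2⟩
  · exact .inl fun u hu => hM (h u hu)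
  · exact .inr ⟨Q, h1.trans hM, h2⟩

/-- The vertices of `X` use up at most `X.card` labels of `Q`, which leaves `j` labels untouched by
`X`. This is how a solution misses marked components. -/
theorem exists_of_card_add_le {V : Type*} {L : V → ℕ} {N : V → Prop} {Q : Finset ℕ}
    (X : Finset V) (j : ℕ) (hQ : ∀ l ∈ Q, ∃ u, N u ∧ L u = l) (h : X.card + j ≤ Q.card) :
    ∃ x : Fin j → V, Function.Injective (L ∘ x) ∧
      ∀ i, N (x i) ∧ L (x i) ∈ Q ∧ ∀ y ∈ X, L y ≠ L (x i) := by
  classical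
  have hcard : j ≤ (Q \ X.image L).card := by
    have h1 := Finset.le_card_sdiff (X.image L) Q
    have h2 : (X.image L).card ≤ X.card := Finset.card_image_le
    omega
  obtain ⟨R, hR, hRj⟩ := Finset.exists_subset_card_eq hcard
  let e := (R.equivFinOfCardEq hRj).symm
  have he (i : Fin j) : (e i : ℕ) ∈ Q ∧ (e i : ℕ) ∉ X.image L := by
    simpa using hR (e i).2
  choose x hx hxe using fun i => hQ (e i) (he i).1
  refine ⟨x, fun a b hab => ?_, fun i => ⟨hx i, hxe i ▸ (he i).1, fun y hy hyx => ?_⟩⟩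
  · simp only [Function.comp_apply, hxe] at hab
    exact e.injective (Subtype.ext hab)
  · exact (he i).2 (Finset.mem_image.2 ⟨y, hy, hyx.trans (hxe i)⟩)

theorem IsYesInstance.induce {V : Type*} {G : SimpleGraph V} {k : ℕ} (h : IsYesInstance G k)
    (s : Set V) : IsYesInstance (G.induce s) k := by
  classical
  obtain ⟨X, hX, hG⟩ := h
  refine ⟨X.subtype (· ∈ s), ?_, hG.of_embedding ⟨⟨fun v => ⟨v.1.1, ?_⟩, ?_⟩, Iff.rfl⟩⟩
  · rw [Finset.card_subtype]
    exact (Finset.card_filter_le _ _).trans hX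
  · have := v.2
    simpa using this
  · intro u v huv
    simpa [Subtype.ext_iff] using huv

/-- The vertices outside the modulator fall into classes of equal label without edges between
them. It suffices to keep the classes marked in `M`: every vertex of the modulator that sees an
unmarked class is the centre of a claw in each solution avoiding it. -/
theorem isYesInstance_induce_iff {V : Type*} {G : SimpleGraph V} {k : ℕ} {S T : Finset V}
    {L : V → ℕ} {M₀ M : Finset ℕ} (hG : IsProperHellyCircularArc (G.induce {v | v ∉ T}))
    (hL : ∀ u w, u ∉ T → w ∉ T → G.Adj u w → L u = L w) (hM : M₀ ⊆ M)
    (hS : ∀ v, v ∈ S ↔ v ∈ T ∨ L v ∈ M)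
    (hsat : ∀ v ∈ T, Saturated L (fun u => u ∉ T ∧ G.Adj v u) (k + 3) ∅ M₀)
    (hextra : Saturated L (fun u => u ∉ T) (k + 3) M₀ M) :
    IsYesInstance (G.induce {v | v ∈ S}) k ↔ IsYesInstance G k := by
  classical
  refine ⟨?_, fun h => h.induce _⟩
  rintro ⟨X, hXk, hX⟩
  let Y : Finset V := X.map (Function.Embedding.subtype _)
  have hYk : Y.card ≤ k := by simpa [Y] using hXk
  have hY (v : V) (hv : v ∈ S) : v ∈ Y ↔ ⟨v, hv⟩ ∈ X := by simp [Y, hv]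
  have hA : IsProperHellyCircularArc (G.induce {v | v ∈ S ∧ v ∉ Y}) := by
    refine hX.of_embedding ⟨⟨fun v => ⟨⟨v.1, v.2.1⟩, ?_⟩, ?_⟩, Iff.rfl⟩
    · exact (hY v v.2.1).not.1 v.2.2
    · intro u v huv
      simpa [Subtype.ext_iff] using huv
  -- A surviving vertex of the modulator sees only components in `M₀`: otherwise three of its `k +
  -- 3` marked components avoid `Y` and give a claw.
  have hno (v) (hv : v ∈ T) (hvY : v ∉ Y) (u) (hu : u ∉ T) (huv : G.Adj v u) : L u ∈ M₀ := by
    rcases hsat v hv with h | ⟨Q, hQM, -, hQk, hQ⟩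
    · exact h u ⟨hu, huv⟩
    · obtain ⟨x, hxi, hx⟩ := exists_of_card_add_le Y 3 hQ (by omega)
      have hxA (i) : x i ∈ S ∧ x i ∉ Y :=
        ⟨(hS _).2 (.inr (hM (hQM (hx i).2.1))), fun h => (hx i).2.2 _ h rfl⟩
      refine (hA.claw_free ⟨v, (hS v).2 (.inl hv), hvY⟩ (fun i => ⟨x i, hxA i⟩)
        (fun i j hij => hxi.of_comp (Subtype.ext_iff.1 hij)) (fun i => (hx i).1.2)
        fun i j hij => ?_).elim
      have hij' : G.Adj (x i) (x j) := hij
      obtain rfl := hxi (hL _ _ (hx i).1.1 (hx j).1.1 hij')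
      exact hij'.ne rfl
  refine ⟨Y, hYk, ?_⟩
  rcases hextra with h | ⟨Q, hQM, hQ₀, hQk, hQ⟩
  · refine hA.of_embedding ⟨⟨fun v => ⟨v.1, ?_, v.2⟩, ?_⟩, Iff.rfl⟩
    · by_cases hv : v.1 ∈ T
      · exact (hS _).2 (.inl hv)
      · exact (hS _).2 (.inr (h _ hv))
    · intro u v huv
      simpa [Subtype.ext_iff] using huv
  -- Two untouched components outside `M₀`: one is split off, the other witnesses that something
  -- remains.
  · obtain ⟨x, hxi, hx⟩ := exists_of_card_add_le Y 2 hQ (by omega)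
    have hne : L (x 1) ≠ L (x 0) := fun e => by simpa using hxi e
    have hxA (i) : x i ∈ S ∧ x i ∉ Y :=
      ⟨(hS _).2 (.inr (hQM (hx i).2.1)), fun h => (hx i).2.2 _ h rfl⟩
    have hPA : IsProperInterval (G.induce {v | v ∈ S ∧ v ∉ Y}) := by
      refine hA.isProperInterval {v | v.1 ∉ T ∧ L v = L (x 0)} ⟨x 0, hxA 0⟩ ⟨x 1, hxA 1⟩
        ⟨(hx 0).1, rfl⟩ (fun h => hne h.2) ?_
      rintro ⟨u, hu⟩ ⟨huT, huL⟩ ⟨w, hw⟩ hws (huw : G.Adj u w)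
      by_cases hwT : w ∈ T
      · have h1 := hno w hwT hw.2 u huT huw.symm
        rw [huL] at h1
        exact Finset.disjoint_left.1 hQ₀ (hx 0).2.1 h1
      · exact hws ⟨hwT, (hL u w huT hwT huw).symm.trans huL⟩
    have hPT : IsProperInterval (G.induce {v | v ∉ T}) := by
      refine hG.isProperInterval {v | L v = L (x 0)} ⟨x 0, (hx 0).1⟩ ⟨x 1, (hx 1).1⟩
        rfl hne ?_
      rintro ⟨u, hu⟩ huL ⟨w, hw⟩ hws (huw : G.Adj u w)
      exact hws ((hL u w hu hw huw).symm.trans huL)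
    -- The kept part lies in the first proper interval graph, the deleted part in the second; by
    -- `hno` no edge joins them.
    refine (IsProperInterval.of_split {v | v.1 ∈ S} ?_ ?_ ?_).isProperHellyCircularArc
    · refine hPA.of_embedding ⟨⟨fun v => ⟨v.1.1, v.2, v.1.2⟩, ?_⟩, Iff.rfl⟩
      intro u v huv
      simpa [Subtype.ext_iff] using huv
    · refine hPT.of_embedding ⟨⟨fun v => ⟨v.1.1, fun h => v.2 ((hS _).2 (.inl h))⟩, ?_⟩, Iff.rfl⟩
      intro u v huv
      simpa [Subtype.ext_iff] using huv
    · rintro ⟨u, huY⟩ (huS : u ∈ S) ⟨w, hwY⟩ (hwS : w ∉ S) (huw : G.Adj u w)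
      rw [hS, not_or] at hwS
      by_cases huT : u ∈ T
      · exact hwS.2 (hM (hno u huT huY w hwS.1 huw))
      · refine hwS.2 (hL u w huT hwS.1 huw ▸ ?_)
        exact ((hS u).1 huS).resolve_left huT

/-! ### Labels and connected components -/

/-- The subgraph of the edges that avoid `T`. -/
def outside {V : Type*} (G : SimpleGraph V) (T : Finset V) : SimpleGraph V where
  Adj u v := G.Adj u v ∧ u ∉ T ∧ v ∉ T
  symm := ⟨fun _ _ h => ⟨h.1.symm, h.2.2, h.2.1⟩⟩
  loopless := ⟨fun _ h => h.1.ne rfl⟩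

theorem reachable_induce_of_walk {V : Type*} {G : SimpleGraph V} {T : Finset V} {s : Set V}
    (hs : ∀ u w, u ∈ s → (outside G T).Adj u w → w ∈ s) {x y : V}
    (p : (outside G T).Walk x y) (hx : x ∈ s) (hy : y ∈ s) :
    (G.induce s).Reachable ⟨x, hx⟩ ⟨y, hy⟩ := by
  induction p with
  | nil => exact .refl _
  | cons h _ ih =>
    have hz := hs _ _ hx h
    have hadj : (G.induce s).Adj ⟨_, hx⟩ ⟨_, hz⟩ := h.1
    exact hadj.reachable.trans (ih hz hy)

/-- Kept label classes are closed under edges outside `T`, so paths joining equally labelled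
vertices survive, and a component is determined by its label. -/
theorem numComponents_le {V : Type*} {G : SimpleGraph V} {S T : Finset V} {L : V → ℕ}
    {M : Finset ℕ} (hL : ∀ u w, u ∉ T → w ∉ T → G.Adj u w → L u = L w)
    (hconn : ∀ x y, L x = L y → (outside G T).Reachable x y)
    (hS : ∀ v, v ∈ S ↔ v ∈ T ∨ L v ∈ M) :
    numComponents (G.induce {v | v ∈ S ∧ v ∉ T}) ≤ M.card := by
  have hmem (v : {v | v ∈ S ∧ v ∉ T}) : L v ∈ M := ((hS v).1 v.2.1).resolve_left v.2.2
  rw [numComponents, show M.card = Nat.card M by simp]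
  let f (C : (G.induce {v | v ∈ S ∧ v ∉ T}).ConnectedComponent) : M :=
    ⟨L C.out, hmem _⟩
  refine Nat.card_le_card_of_injective f fun C D h => ?_
  rw [← Quot.out_eq C, ← Quot.out_eq D]
  refine SimpleGraph.ConnectedComponent.sound ?_
  obtain ⟨p⟩ := hconn _ _ (Subtype.ext_iff.1 h)
  refine reachable_induce_of_walk (s := {v | v ∈ S ∧ v ∉ T})
    (fun u w hu huw => ⟨(hS w).2 (.inr ?_), huw.2.2⟩) p (Quot.out C).2 (Quot.out D).2
  exact hL u w huw.2.1 huw.2.2 huw.1 ▸ ((hS u).1 hu.1).resolve_left hu.2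

/-! ### Reasoning about programs -/

/-- Started in `s`, the program `p` halts within `B` steps in a memory that satisfies `Q`. -/
def Spec (p : Program) (s : Memory) (B : ℕ) (Q : Memory → Prop) : Prop :=
  ∃ t s', Runs p s t s' ∧ t ≤ B ∧ Q s'

theorem Spec.mono {p : Program} {s : Memory} {B B' : ℕ} {Q Q' : Memory → Prop}
    (h : Spec p s B Q) (hB : B ≤ B') (hQ : ∀ s', Q s' → Q' s') : Spec p s B' Q' := by
  obtain ⟨t, s', h1, h2, h3⟩ := h
  exact ⟨t, s', h1, h2.trans hB, hQ _ h3⟩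

theorem Spec.skip {s : Memory} {B : ℕ} {Q : Memory → Prop} (h : Q s) (hB : 1 ≤ B) :
    Spec .skip s B Q :=
  ⟨_, _, .skip s, hB, h⟩

theorem Spec.assign {s : Memory} {x : ℕ} {e : Expr} {B : ℕ} {Q : Memory → Prop}
    (h : Q (s.setReg x (e.eval s))) (hB : e.cost + 1 ≤ B) : Spec (.assign x e) s B Q :=
  ⟨_, _, .assign s x e, hB, h⟩

theorem Spec.store {s : Memory} {a : ℕ} {i j e : Expr} {B : ℕ} {Q : Memory → Prop}
    (h : Q (s.setArr a (i.eval s) (j.eval s) (e.eval s)))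
    (hB : i.cost + j.cost + e.cost + 1 ≤ B) : Spec (.store a i j e) s B Q :=
  ⟨_, _, .store s a i j e, hB, h⟩

theorem Spec.seq {p q : Program} {s : Memory} {B₁ B₂ B : ℕ} {R Q : Memory → Prop}
    (hp : Spec p s B₁ R) (hq : ∀ s', R s' → Spec q s' B₂ Q) (hB : B₁ + B₂ ≤ B) :
    Spec (.seq p q) s B Q := by
  obtain ⟨t, s', h1, h2, h3⟩ := hp
  obtain ⟨t', s'', h4, h5, h6⟩ := hq s' h3
  exact ⟨_, _, .seq h1 h4, by omega, h6⟩

theorem Spec.cond {e : Expr} {p q : Program} {s : Memory} {B' B : ℕ} {Q : Memory → Prop}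
    (hp : e.eval s ≠ 0 → Spec p s B' Q) (hq : e.eval s = 0 → Spec q s B' Q)
    (hB : e.cost + 1 + B' ≤ B) : Spec (.cond e p q) s B Q := by
  by_cases he : e.eval s = 0
  · obtain ⟨t, s', h1, h2, h3⟩ := hq he
    exact ⟨_, _, .cond_false he h1, by omega, h3⟩
  · obtain ⟨t, s', h1, h2, h3⟩ := hp he
    exact ⟨_, _, .cond_true he h1, by omega, h3⟩

/-- The loop in which register `x` runs through the numbers below register 0. -/
def forLoop (x : ℕ) (p : Program) : Program :=
  .seq (.assign x (.const 0))
    (.loop (.sub (.reg 0) (.reg x)) (.seq p (.assign x (.add (.reg x) (.const 1)))))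

/-- Each round costs 4 for the test and 4 for the increment besides the body; the extra round pays
for the initial assignment and the last test. -/
theorem Spec.forLoop {x : ℕ} {p : Program} {s : Memory} {n B : ℕ} (I : ℕ → Memory → Prop)
    (h₀ : I 0 (s.setReg x 0)) (hI : ∀ i s', I i s' → s'.reg 0 = n ∧ s'.reg x = i)
    (hp : ∀ i s', i < n → I i s' →
      Spec p s' B fun s'' => s''.reg x = i ∧ I (i + 1) (s''.setReg x (i + 1))) :
    Spec (forLoop x p) s ((n + 1) * (B + 8)) (I n) := by
  -- Induction on the number `j` of rounds left.
  have key (j : ℕ) : ∀ i s', i + j = n → I i s' →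
      Spec (.loop (.sub (.reg 0) (.reg x)) (.seq p (.assign x (.add (.reg x) (.const 1))))) s'
        (4 + j * (B + 8)) (I n) := by
    induction j with
    | zero =>
      intro i s' hij hs
      obtain ⟨h0, hx⟩ := hI i s' hs
      obtain rfl : i = n := hij
      exact ⟨_, _, .loop_done (by simp [Expr.eval, h0, hx]), by simp [Expr.cost], hs⟩
    | succ j ih =>
      intro i s' hij hs
      obtain ⟨h0, hx⟩ := hI i s' hs
      obtain ⟨t, s₁, h1, h2, h3, h4⟩ := hp i s' (by omega) hs
      obtain ⟨t', s₂, h5, h6, h7⟩ := ih (i + 1) (s₁.setReg x (i + 1)) (by omega) h4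
      have hstep := Runs.assign s₁ x (.add (.reg x) (.const 1))
      simp only [Expr.eval, h3] at hstep
      refine ⟨_, _, .loop_step (by simp only [Expr.eval, h0, hx]; omega) (.seq h1 hstep) h5,
        ?_, h7⟩
      simp only [Expr.cost]
      linarith [add_mul j 1 (B + 8)]
  obtain ⟨t, s', h1, h2, h3⟩ := key n 0 _ (by omega) h₀
  refine ⟨_, _, .seq (.assign s x (.const 0)) h1, ?_, h3⟩
  simp only [Expr.cost]
  linarith [add_mul n 1 (B + 8)]

/-- The contents of the memory: the number `n` of labels, the parameter `k`, the adjacency matrix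
`A`, the vertex set `V`, the modulator `T`, the labelling `L` and the set `M` of marked labels. -/
structure Holds (s : Memory) (n k : ℕ) (A : ℕ → ℕ → ℕ) (V T L : ℕ → ℕ) (M : Finset ℕ) :
    Prop where
  reg0 : s.reg 0 = n
  reg1 : s.reg 1 = k
  arr0 : ∀ i j, s.arr 0 i j = A i j
  arr1 : ∀ i, s.arr 1 i 0 = V i
  arr2 : ∀ i, s.arr 2 i 0 = T i
  arr3 : ∀ i, s.arr 3 i 0 = L i
  arr4 : ∀ i, s.arr 4 i 0 = if i ∈ M then 1 else 0

/-! ### Effect of writes on the memory contents -/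

section
variable {s : Memory} {n k : ℕ} {A : ℕ → ℕ → ℕ} {V T L : ℕ → ℕ} {M : Finset ℕ}

theorem Holds.setReg (h : Holds s n k A V T L M) {x m : ℕ} (hx : 2 ≤ x) :
    Holds (s.setReg x m) n k A V T L M :=
  ⟨by simp [Memory.setReg, h.reg0, show 0 ≠ x by omega],
    by simp [Memory.setReg, h.reg1, show 1 ≠ x by omega], h.arr0, h.arr1, h.arr2, h.arr3, h.arr4⟩

theorem Holds.storeAdj (h : Holds s n k A V T L M) (i j m : ℕ) :
    Holds (s.setArr 0 i j m) n k (fun a b => if a = i ∧ b = j then m else A a b) V T L M :=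
  ⟨h.reg0, h.reg1, by simp [Memory.setArr, h.arr0], by simp [Memory.setArr, h.arr1],
    by simp [Memory.setArr, h.arr2], by simp [Memory.setArr, h.arr3],
    by simp [Memory.setArr, h.arr4]⟩

theorem Holds.storeVertex (h : Holds s n k A V T L M) (i m : ℕ) :
    Holds (s.setArr 1 i 0 m) n k A (fun a => if a = i then m else V a) T L M :=
  ⟨h.reg0, h.reg1, by simp [Memory.setArr, h.arr0], by simp [Memory.setArr, h.arr1],
    by simp [Memory.setArr, h.arr2], by simp [Memory.setArr, h.arr3],
    by simp [Memory.setArr, h.arr4]⟩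

theorem Holds.storeLabel (h : Holds s n k A V T L M) (i m : ℕ) :
    Holds (s.setArr 3 i 0 m) n k A V T (fun a => if a = i then m else L a) M :=
  ⟨h.reg0, h.reg1, by simp [Memory.setArr, h.arr0], by simp [Memory.setArr, h.arr1],
    by simp [Memory.setArr, h.arr2], by simp [Memory.setArr, h.arr3],
    by simp [Memory.setArr, h.arr4]⟩

theorem Holds.storeMark (h : Holds s n k A V T L M) (i : ℕ) :
    Holds (s.setArr 4 i 0 1) n k A V T L (insert i M) :=
  ⟨h.reg0, h.reg1, by simp [Memory.setArr, h.arr0], by simp [Memory.setArr, h.arr1],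
    by simp [Memory.setArr, h.arr2], by simp [Memory.setArr, h.arr3], fun a => by
      by_cases ha : a = i <;> simp [Memory.setArr, h.arr4, ha]⟩

/-! ### The components -/

/-- Give each vertex its own label. -/
def initLabels : Program :=
  forLoop 2 (.store 3 (.reg 2) (.const 0) (.reg 2))

theorem initLabels_spec (h : Holds s n k A V T L M) :
    Spec initLabels s ((n + 1) * (4 + 8)) fun s' =>
      ∃ L', (∀ i < n, L' i = i) ∧ s'.reg 8 = s.reg 8 ∧ Holds s' n k A V T L' M := by
  refine (Spec.forLoop (n := n) (B := 4) (fun i s' => s'.reg 2 = i ∧ s'.reg 8 = s.reg 8 ∧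
    ∃ L', (∀ j < i, L' j = j) ∧ Holds s' n k A V T L' M) ?_ ?_ ?_).mono le_rfl ?_
  · exact ⟨by simp [Memory.setReg], by simp [Memory.setReg], L, by simp, h.setReg le_rfl⟩
  · rintro i s' ⟨h2, -, L', -, h'⟩
    exact ⟨h'.reg0, h2⟩
  · rintro i s' hi ⟨h2, h8, L', hL, h'⟩
    refine Spec.store ?_ (by simp [Expr.cost])
    refine ⟨h2, by simp [Memory.setReg], h8, _, ?_,
      (h'.storeLabel _ _).setReg le_rfl⟩
    intro j hj
    by_cases hji : j = i
    · simp [Expr.eval, h2, hji]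
    · simpa [Expr.eval, h2, hji] using hL j (by omega)
  · rintro s' ⟨-, h8, L', hL, h'⟩
    exact ⟨L', hL, h8, h'⟩

/-- Merge the label of register 2 into that of register 3. -/
def mergeLabels : Program :=
  .seq (.assign 5 (.get 3 (.reg 2) (.const 0)))
    (.seq (.assign 6 (.get 3 (.reg 3) (.const 0)))
      (forLoop 4
        (.cond
          (.add (.sub (.get 3 (.reg 4) (.const 0)) (.reg 5))
            (.sub (.reg 5) (.get 3 (.reg 4) (.const 0))))
          .skip (.store 3 (.reg 4) (.const 0) (.reg 6)))))

/-- Both labels are saved in registers first, as the loop overwrites them. The sum of the two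
truncated differences vanishes exactly for equal labels. -/
theorem mergeLabels_spec (h : Holds s n k A V T L M) {i j : ℕ} (hi : s.reg 2 = i)
    (hj : s.reg 3 = j) :
    Spec mergeLabels s (8 + (n + 1) * (16 + 8)) fun s' =>
      s'.reg 2 = i ∧ s'.reg 3 = j ∧ s'.reg 8 = s.reg 8 ∧
      ∃ L', (∀ x < n, L' x = if L x = L i then L j else L x) ∧ Holds s' n k A V T L' M := by
  let s₁ := (s.setReg 5 (L i)).setReg 6 (L j)
  refine Spec.seq (B₁ := 4) (B₂ := 4 + (n + 1) * (16 + 8)) (R := (· = s.setReg 5 (L i)))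
    (Spec.assign (by simp [Expr.eval, hi, h.arr3]) (by simp [Expr.cost])) ?_ (by omega)
  rintro _ rfl
  refine Spec.seq (B₁ := 4) (B₂ := (n + 1) * (16 + 8)) (R := (· = s₁))
    (Spec.assign ?_ (by simp [Expr.cost])) ?_ (by omega)
  · have h5 := h.setReg (x := 5) (m := L i) (by omega)
    simp [Expr.eval, s₁, h5.arr3, show (s.setReg 5 (L i)).reg 3 = j by simp [Memory.setReg, hj]]
  rintro _ rfl
  refine (Spec.forLoop (n := n) (fun a s' => s'.reg 4 = a ∧ s'.reg 2 = i ∧ s'.reg 3 = j ∧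
    s'.reg 5 = L i ∧ s'.reg 6 = L j ∧ s'.reg 8 = s.reg 8 ∧
    ∃ L', (∀ x < n, L' x = if x < a ∧ L x = L i then L j else L x) ∧
      Holds s' n k A V T L' M) ?_ ?_ ?_).mono le_rfl ?_
  · refine ⟨by simp [Memory.setReg], by simp [Memory.setReg, s₁, hi],
      by simp [Memory.setReg, s₁, hj], by simp [Memory.setReg, s₁],
      by simp [Memory.setReg, s₁], by simp [Memory.setReg, s₁], L, by simp, ?_⟩
    exact ((h.setReg (by omega)).setReg (by omega)).setReg (by omega)
  · rintro a s' ⟨h4, -, -, -, -, -, L', -, h'⟩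
    exact ⟨h'.reg0, h4⟩
  · rintro a s' ha ⟨h4, h2, h3, h5, h6, h8, L', hL, h'⟩
    have hLa : L' a = L a := by simpa using hL a ha
    refine Spec.cond (B' := 4) (fun he => Spec.skip ?_ (by omega)) (fun he => Spec.store ?_ ?_) ?_
    · simp only [Expr.eval, h4, h5, h'.arr3, hLa] at he
      refine ⟨h4, by simp [Memory.setReg], h2, h3, h5, h6, h8, L', fun x hx => ?_,
        h'.setReg (by omega)⟩
      rw [hL x hx]
      by_cases hxa : x = a
      · subst hxa
        simp [show ¬ L x = L i by omega]
      · simp [show x < a + 1 ↔ x < a by omega]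
    · simp only [Expr.eval, h4, h5, h'.arr3, hLa] at he
      refine ⟨h4, by simp [Memory.setReg], h2, h3, h5, h6, h8, _, fun x hx => ?_,
        (h'.storeLabel _ _).setReg (by omega)⟩
      by_cases hxa : x = a
      · subst hxa
        simp [Expr.eval, h4, h6, show L x = L i by omega]
      · simp [Expr.eval, h4, hxa, hL x hx, show x < a + 1 ↔ x < a by omega]
    · simp [Expr.cost]
    · simp [Expr.cost]
  · rintro s' ⟨-, h2, h3, -, -, h8, L', hL, h'⟩
    exact ⟨h2, h3, h8, L', fun x hx => by simp [hL x hx, hx], h'⟩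

/-- Merge the labels of the ends of all edges outside the modulator. -/
def mergeEdges : Program :=
  forLoop 2 (forLoop 3
    (.cond
      (.sub (.sub (.get 0 (.reg 2) (.reg 3)) (.get 2 (.reg 2) (.const 0)))
        (.get 2 (.reg 3) (.const 0)))
      mergeLabels .skip))

/-- `E` stands for adjacency and `C` for reachability outside the modulator. Merging never separates
equal labels, so one pass over all pairs suffices. -/
theorem mergeEdges_spec (h : Holds s n k A V T L M) {E : ℕ → ℕ → Prop} {C : ℕ → ℕ → Prop}
    (hE : ∀ i < n, ∀ j < n, E i j ↔ A i j - T i - T j ≠ 0)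
    (hEC : ∀ i < n, ∀ j < n, E i j → C i j) (hsymm : ∀ x y, C x y → C y x)
    (htrans : ∀ x y z, C x y → C y z → C x z) (hL : ∀ x < n, ∀ y < n, L x = L y → C x y) :
    Spec mergeEdges s ((n + 1) * ((n + 1) * (12 + (8 + (n + 1) * (16 + 8)) + 8) + 8)) fun s' =>
      s'.reg 8 = s.reg 8 ∧ ∃ L', (∀ x < n, ∀ y < n, L' x = L' y → C x y) ∧
      (∀ x < n, ∀ y < n, E x y → L' x = L' y) ∧ Holds s' n k A V T L' M := by
  -- The pairs before `(i, j)` in lexicographic order have been processed.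
  let J (i j : ℕ) (s' : Memory) : Prop := s'.reg 8 = s.reg 8 ∧
    ∃ L', (∀ x < n, ∀ y < n, L' x = L' y → C x y) ∧
    (∀ x < n, ∀ y < n, E x y → x < i ∨ x = i ∧ y < j → L' x = L' y) ∧ Holds s' n k A V T L' M
  have hJ (i j : ℕ) (s' : Memory) (x m : ℕ) (hx : 2 ≤ x) (hx8 : x ≠ 8) (hs : J i j s') :
      J i j (s'.setReg x m) := by
    obtain ⟨h8, L', h1, h2, h3⟩ := hs
    exact ⟨by simpa [Memory.setReg, hx8.symm] using h8, L', h1, h2, h3.setReg hx⟩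
  refine (Spec.forLoop (n := n) (fun i s' => s'.reg 2 = i ∧ J i 0 s') ?_ ?_ ?_).mono le_rfl ?_
  · refine ⟨by simp [Memory.setReg], hJ _ _ _ _ _ le_rfl (by omega) ⟨rfl, L, hL, ?_, h⟩⟩
    rintro x hx y hy - h'
    omega
  · rintro i s' ⟨h2, -, L', -, -, h'⟩
    exact ⟨h'.reg0, h2⟩
  · rintro i s' hi ⟨h2, hs'⟩
    refine (Spec.forLoop (n := n) (fun j s'' => s''.reg 3 = j ∧ s''.reg 2 = i ∧ J i j s'')
      ⟨by simp [Memory.setReg], by simpa [Memory.setReg] using h2,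
        hJ _ _ _ _ _ (by omega) (by omega) hs'⟩ ?_ ?_).mono le_rfl ?_
    · rintro j s'' ⟨h3, -, -, L', -, -, h'⟩
      exact ⟨h'.reg0, h3⟩
    · rintro j s₁ hj ⟨h3, h2, h8, L', hL', hE', h'⟩
      refine Spec.cond (B' := 8 + (n + 1) * (16 + 8)) (fun he => ?_)
        (fun he => Spec.skip ?_ (by omega)) (by simp [Expr.cost])
      · simp only [Expr.eval, h2, h3, h'.arr0, h'.arr2] at he
        have hij := (hE i hi j hj).2 he
        refine (mergeLabels_spec h' h2 h3).mono le_rfl ?_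
        rintro s₂ ⟨h2', h3', h8', L₂, hL₂, h₂⟩
        refine ⟨h3', by simp [Memory.setReg], by simpa [Memory.setReg] using h2',
          hJ _ _ _ _ _ (by omega) (by omega) ⟨h8'.trans h8, L₂, ?_, ?_, h₂⟩⟩
        · intro x hx y hy hxy
          rw [hL₂ x hx, hL₂ y hy] at hxy
          have hCij := hEC i hi j hj hij
          split_ifs at hxy with hxi hyi hyi
          · exact hL' x hx y hy (hxi.trans hyi.symm)
          · exact htrans _ _ _ (hL' x hx i hi hxi) (htrans _ _ _ hCij (hL' j hj y hy hxy))
          · exact htrans _ _ _ (hL' x hx j hj hxy)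
              (htrans _ _ _ (hsymm _ _ hCij) (hL' i hi y hy hyi.symm))
          · exact hL' x hx y hy hxy
        · intro x hx y hy hxy hlt
          rw [hL₂ x hx, hL₂ y hy]
          by_cases hx' : x = i ∧ y = j
          · obtain ⟨rfl, rfl⟩ := hx'
            simp
          · rw [hE' x hx y hy hxy (by omega)]
      · simp only [Expr.eval, h2, h3, h'.arr0, h'.arr2] at he
        refine ⟨h3, by simp [Memory.setReg], by simpa [Memory.setReg] using h2,
          hJ _ _ _ _ _ (by omega) (by omega) ⟨h8, L', hL', ?_, h'⟩⟩
        intro x hx y hy hxy hlt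
        by_cases hx' : x = i ∧ y = j
        · obtain ⟨rfl, rfl⟩ := hx'
          exact absurd he ((hE x hx y hy).1 hxy)
        · exact hE' x hx y hy hxy (by omega)
    · rintro s'' ⟨-, h2, h8, L', hL', hE', h'⟩
      refine ⟨h2, by simp [Memory.setReg], hJ _ _ _ _ _ (by omega) (by omega)
        ⟨h8, L', hL', ?_, h'⟩⟩
      intro x hx y hy hxy hlt
      exact hE' x hx y hy hxy (by omega)
  · rintro s' ⟨-, h8, L', hL', hE', h'⟩
    exact ⟨h8, L', hL', fun x hx y hy hxy => hE' x hx y hy hxy (by omega), h'⟩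

/-! ### Marking components -/

/-- Mark up to `k + 3` unmarked labels of neighbours of the vertex in register 2; the number `n`
there stands for an additional vertex that is adjacent to all. -/
def markLabels : Program :=
  .seq (.assign 7 (.const 0))
    (forLoop 3
      (.cond
        (.sub (.sub (.add (.get 0 (.reg 2) (.reg 3)) (.sub (.add (.reg 2) (.const 1)) (.reg 0)))
          (.get 2 (.reg 3) (.const 0))) (.get 4 (.get 3 (.reg 3) (.const 0)) (.const 0)))
        (.cond (.sub (.add (.reg 1) (.const 3)) (.reg 7))
          (.seq (.store 4 (.get 3 (.reg 3) (.const 0)) (.const 0) (.const 1))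
            (.assign 7 (.add (.reg 7) (.const 1))))
          .skip)
        .skip))

/-- The summand `i + 1 - n` is 0 for `i < n` and 1 for `i = n`, the additional vertex. As the sum is
at most 1, subtracting the modulator flag and the mark leaves a nonzero value only if both vanish.
-/
theorem markLabels_spec (h : Holds s n k A V T L M) {i : ℕ} (hi : s.reg 2 = i)
    {N : ℕ → Prop} (hA : ∀ u < n, A i u + (i + 1 - n) ≤ 1)
    (hN : ∀ u < n, N u ↔ A i u + (i + 1 - n) ≠ 0 ∧ T u = 0) :
    Spec markLabels s (2 + (n + 1) * (37 + 8)) fun s' =>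
      s'.reg 2 = i ∧ s'.reg 8 = s.reg 8 ∧
      ∃ M', M ⊆ M' ∧ M'.card ≤ M.card + (k + 3) ∧
        Saturated (fun u : Fin n => L u) (fun u => N u) (k + 3) M M' ∧
        Holds s' n k A V T L M' := by
  refine Spec.seq (B₁ := 2) (B₂ := (n + 1) * (37 + 8)) (R := (· = s.setReg 7 0))
    (Spec.assign (by simp [Expr.eval]) (by simp [Expr.cost])) ?_ (by omega)
  rintro _ rfl
  -- `Q` is the set of newly marked labels, counted by register 7. A label is skipped only if it is
  -- marked or the quota is full.
  refine (Spec.forLoop (n := n) (fun j s' => s'.reg 3 = j ∧ s'.reg 2 = i ∧ s'.reg 8 = s.reg 8 ∧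
    ∃ Q : Finset ℕ, s'.reg 7 = Q.card ∧ Disjoint Q M ∧ Q.card ≤ k + 3 ∧
      (∀ l ∈ Q, ∃ u, u < n ∧ N u ∧ L u = l) ∧
      (k + 3 ≤ Q.card ∨ ∀ u < j, N u → L u ∈ M ∪ Q) ∧
      Holds s' n k A V T L (M ∪ Q)) ?_ ?_ ?_).mono le_rfl ?_
  · refine ⟨by simp [Memory.setReg], by simp [Memory.setReg, hi], by simp [Memory.setReg], ∅,
      by simp [Memory.setReg], by simp, by simp, by simp, by simp, ?_⟩
    simpa using (h.setReg (x := 7) (by omega)).setReg (x := 3) (by omega)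
  · rintro j s' ⟨h3, -, -, Q, -, -, -, -, -, h'⟩
    exact ⟨h'.reg0, h3⟩
  · rintro j s' hj ⟨h3, h2, h8, Q, h7, hQM, hQk, hQN, hQ, h'⟩
    have hAj := hA j hj
    have hNj := hN j hj
    have hskip (hcon : k + 3 ≤ Q.card ∨ (N j → L j ∈ M ∪ Q)) :
        Spec .skip s' 1 fun s'' => s''.reg 3 = j ∧
          (s''.setReg 3 (j + 1)).reg 3 = j + 1 ∧ (s''.setReg 3 (j + 1)).reg 2 = i ∧
          (s''.setReg 3 (j + 1)).reg 8 = s.reg 8 ∧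
          ∃ Q : Finset ℕ, (s''.setReg 3 (j + 1)).reg 7 = Q.card ∧ Disjoint Q M ∧
          Q.card ≤ k + 3 ∧ (∀ l ∈ Q, ∃ u, u < n ∧ N u ∧ L u = l) ∧
          (k + 3 ≤ Q.card ∨ ∀ u < j + 1, N u → L u ∈ M ∪ Q) ∧
          Holds (s''.setReg 3 (j + 1)) n k A V T L (M ∪ Q) := by
      refine Spec.skip ⟨h3, by simp [Memory.setReg], h2, h8, Q, h7, hQM, hQk, hQN, ?_,
        h'.setReg (by omega)⟩ le_rfl
      rcases hcon with hcon | hcon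
      · exact .inl hcon
      · refine hQ.imp_right fun hQ u hu hNu => ?_
        rcases Nat.lt_succ_iff_lt_or_eq.1 hu with hu | rfl
        · exact hQ u hu hNu
        · exact hcon hNu
    refine Spec.cond (B' := 17) (fun he => ?_) (fun he => ?_) (by simp [Expr.cost])
    · simp only [Expr.eval, h2, h3, h'.reg0, h'.arr0, h'.arr2, h'.arr3, h'.arr4] at he
      have hLj : L j ∉ M ∪ Q := fun hmem => by
        rw [if_pos hmem] at he
        omega
      rw [if_neg hLj] at he
      refine Spec.cond (B' := 11) (fun he' => ?_)
        (fun he' => (hskip (.inl ?_)).mono (by omega) fun _ => id) (by simp [Expr.cost])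
      · simp only [Expr.eval, h'.reg1, h7] at he'
        refine Spec.seq (B₁ := 6) (B₂ := 5) (R := (· = s'.setArr 4 (L j) 0 1))
          (Spec.store (by simp [Expr.eval, h3, h'.arr3]) (by simp [Expr.cost])) ?_ le_rfl
        rintro _ rfl
        have hLQ : L j ∉ Q := fun hmem => hLj (Finset.mem_union_right _ hmem)
        have h'' := ((h'.storeMark (L j)).setReg (x := 7) (m := Q.card + 1)
          (by omega)).setReg (x := 3) (m := j + 1) (by omega)
        refine Spec.assign ⟨h3, by simp [Memory.setReg], h2, h8, insert (L j) Q, ?_, ?_, ?_, ?_,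
          ?_, ?_⟩ (by simp [Expr.cost])
        · rw [Finset.card_insert_of_notMem hLQ]
          simp [Expr.eval, Memory.setReg, Memory.setArr, h7]
        · rw [Finset.disjoint_insert_left]
          exact ⟨fun hmem => hLj (Finset.mem_union_left _ hmem), hQM⟩
        · rw [Finset.card_insert_of_notMem hLQ]
          omega
        · intro l hl
          rcases Finset.mem_insert.1 hl with rfl | hl
          · exact ⟨j, hj, hNj.2 (by omega), rfl⟩
          · exact hQN l hl
        · refine .inr fun u hu hNu => ?_
          rw [Finset.union_insert]
          rcases Nat.lt_succ_iff_lt_or_eq.1 hu with hu | rfl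
          · exact Finset.mem_insert_of_mem (hQ.resolve_left (by omega) u hu hNu)
          · exact Finset.mem_insert_self _ _
        · rw [Finset.union_insert]
          simpa [Expr.eval, Memory.setArr, h7] using h''
      · simp only [Expr.eval, h'.reg1, h7] at he'
        omega
    · simp only [Expr.eval, h2, h3, h'.reg0, h'.arr0, h'.arr2, h'.arr3, h'.arr4] at he
      refine (hskip (.inr fun hNu => ?_)).mono (by omega) fun _ => id
      by_contra hLj
      rw [if_neg hLj] at he
      have := hNj.1 hNu
      omega
  · rintro s' ⟨-, h2, h8, Q, -, hQM, hQk, hQN, hQ, h'⟩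
    refine ⟨h2, h8, M ∪ Q, Finset.subset_union_left, ?_, ?_, h'⟩
    · exact (Finset.card_union_le _ _).trans (by omega)
    · rcases hQ with hQ | hQ
      · refine .inr ⟨Q, Finset.subset_union_right, hQM, hQ, fun l hl => ?_⟩
        obtain ⟨u, hu, hNu⟩ := hQN l hl
        exact ⟨⟨u, hu⟩, hNu⟩
      · exact .inl fun u hu => hQ u u.2 hu

/-- Mark labels for each vertex of the modulator, and set register 8 if there is one. -/
def markNeighbors : Program :=
  forLoop 2 (.cond (.get 2 (.reg 2) (.const 0)) (.seq markLabels (.assign 8 (.const 1))) .skip)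

/-- The final value `n` of register 2 is recorded because the next call of `markLabels` uses it as
the additional vertex. Register 8 is the test for an empty modulator, where nothing may be kept. -/
theorem markNeighbors_spec (h : Holds s n k A V T L ∅) (h8 : s.reg 8 = 0)
    (hA : ∀ i < n, ∀ u < n, A i u ≤ 1) :
    Spec markNeighbors s ((n + 1) * (4 + (2 + (2 + (n + 1) * (37 + 8))) + 8)) fun s' =>
      s'.reg 2 = n ∧ (s'.reg 8 = 0 → ∀ v < n, T v = 0) ∧
      ∃ M, M.card ≤ ((Finset.range n).filter (T · ≠ 0)).card * (k + 3) ∧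
        (s'.reg 8 = 0 → M = ∅) ∧ (s'.reg 8 ≠ 0 → ∃ v < n, T v ≠ 0) ∧
        (∀ v < n, T v ≠ 0 → Saturated (fun u : Fin n => L u)
          (fun u => T u = 0 ∧ A v u ≠ 0) (k + 3) ∅ M) ∧
        Holds s' n k A V T L M := by
  refine (Spec.forLoop (n := n) (fun i s' => s'.reg 2 = i ∧ (s'.reg 8 = 0 → ∀ v < i, T v = 0) ∧
    ∃ M, M.card ≤ ((Finset.range i).filter (T · ≠ 0)).card * (k + 3) ∧
      (s'.reg 8 = 0 → M = ∅) ∧ (s'.reg 8 ≠ 0 → ∃ v < n, T v ≠ 0) ∧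
      (∀ v < i, T v ≠ 0 → Saturated (fun u : Fin n => L u)
        (fun u => T u = 0 ∧ A v u ≠ 0) (k + 3) ∅ M) ∧
      Holds s' n k A V T L M) ?_ ?_ ?_).mono le_rfl fun _ => id
  · exact ⟨by simp [Memory.setReg], by simp, ∅, by simp, by simp,
      fun h' => absurd h8 h', by simp, h.setReg (by omega)⟩
  · rintro i s' ⟨h2, -, M, -, -, -, -, h'⟩
    exact ⟨h'.reg0, h2⟩
  · rintro i s' hi ⟨h2, h8, M, hM, hM8, hT8, hsat, h'⟩
    refine Spec.cond (B' := 2 + (2 + (n + 1) * (37 + 8))) (fun he => ?_) (fun he => ?_)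
      (by simp [Expr.cost])
    · simp only [Expr.eval, h2, h'.arr2] at he
      refine Spec.seq (B₁ := 2 + (n + 1) * (37 + 8)) (B₂ := 2)
        (markLabels_spec h' h2 (N := fun u => T u = 0 ∧ A i u ≠ 0) ?_ ?_) ?_ (by omega)
      · intro u hu
        have := hA i hi u hu
        omega
      · intro u hu
        rw [show i + 1 - n = 0 by omega, add_zero, and_comm]
      rintro s₁ ⟨h2', -, M', hMM, hMk, hsat', h₁⟩
      refine Spec.assign ?_ (by simp [Expr.cost])
      refine ⟨h2', by simp [Memory.setReg], by simp [Memory.setReg, Expr.eval], M', ?_,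
        by simp [Memory.setReg, Expr.eval], fun _ => ⟨i, hi, he⟩, ?_,
        (h₁.setReg (by omega)).setReg (by omega)⟩
      · rw [Finset.range_add_one, Finset.filter_insert, if_pos he,
          Finset.card_insert_of_notMem (by simp), add_mul]
        omega
      · intro v hv hTv
        rcases Nat.lt_succ_iff_lt_or_eq.1 hv with hv | rfl
        · exact (hsat v hv hTv).mono hMM
        -- For claws it is irrelevant that the new labels avoid the earlier ones.
        · rcases hsat' with h3 | ⟨Q, h3, -, h4⟩
          · exact .inl h3
          · exact .inr ⟨Q, h3, by simp, h4⟩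
    · simp only [Expr.eval, h2, h'.arr2] at he
      refine Spec.skip ⟨h2, by simp [Memory.setReg], fun h0 v hv => ?_, M, ?_, hM8, hT8,
        fun v hv hTv => ?_, h'.setReg (by omega)⟩ (by omega)
      · rcases Nat.lt_succ_iff_lt_or_eq.1 hv with hv | rfl
        · exact h8 h0 v hv
        · exact he
      · rwa [Finset.range_add_one, Finset.filter_insert, if_neg (by simpa using he)]
      · rcases Nat.lt_succ_iff_lt_or_eq.1 hv with hv | rfl
        · exact hsat v hv hTv
        · exact absurd he hTv

/-! ### Deleting the unmarked components -/

/-- Delete the vertex in register 2. -/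
def deleteVertex : Program :=
  .seq (.store 1 (.reg 2) (.const 0) (.const 0))
    (forLoop 3
      (.seq (.store 0 (.reg 2) (.reg 3) (.const 0)) (.store 0 (.reg 3) (.reg 2) (.const 0))))

theorem deleteVertex_spec (h : Holds s n k A V T L M) {i : ℕ} (hi : s.reg 2 = i)
    (hA : ∀ a b, ¬ (a < n ∧ b < n) → A a b = 0) :
    Spec deleteVertex s (4 + (n + 1) * (8 + 8)) fun s' =>
      s'.reg 2 = i ∧ Holds s' n k (fun a b => if a = i ∨ b = i then 0 else A a b)
        (fun a => if a = i then 0 else V a) T L M := by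
  refine Spec.seq (B₁ := 4) (B₂ := (n + 1) * (8 + 8)) (R := fun s' => s'.reg 2 = i ∧
    Holds s' n k A (fun a => if a = i then 0 else V a) T L M)
    (Spec.store ⟨hi, ?_⟩ (by simp [Expr.cost])) ?_ (by omega)
  · simpa [Expr.eval, hi] using h.storeVertex i 0
  rintro s₁ ⟨h2, h₁⟩
  refine (Spec.forLoop (n := n) (fun j s' => s'.reg 3 = j ∧ s'.reg 2 = i ∧
    Holds s' n k (fun a b => if a = i ∧ b < j ∨ b = i ∧ a < j then 0 else A a b)
      (fun a => if a = i then 0 else V a) T L M) ?_ ?_ ?_).mono le_rfl ?_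
  · exact ⟨by simp [Memory.setReg], h2, by simpa using h₁.setReg (by omega)⟩
  · rintro j s' ⟨h3, -, h'⟩
    exact ⟨h'.reg0, h3⟩
  · rintro j s' hj ⟨h3, h2, h'⟩
    refine Spec.seq (B₁ := 4) (B₂ := 4) (R := (· = s'.setArr 0 i j 0))
      (Spec.store (by simp [Expr.eval, h2, h3]) (by simp [Expr.cost])) ?_ (by omega)
    rintro _ rfl
    refine Spec.store ⟨h3, by simp [Memory.setReg], h2, ?_⟩ (by simp [Expr.cost])
    have h'' := ((h'.storeAdj i j 0).storeAdj j i 0).setReg (x := 3) (m := j + 1) (by omega)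
    have hreg : (s'.setArr 0 i j 0).reg = s'.reg := rfl
    simp only [Expr.eval, hreg, h2, h3]
    convert h'' using 1
    funext a b
    split_ifs <;> omega
  · rintro s' ⟨-, h2, h'⟩
    refine ⟨h2, ?_⟩
    convert h' using 1
    funext a b
    -- Entries outside the `n × n` square are already zero, so clearing up to `n` clears the whole
    -- row and column.
    have := hA a b
    split_ifs <;> omega

/-- Delete the vertices outside the modulator with unmarked label. -/
def deleteUnmarked : Program :=
  forLoop 2
    (.cond
      (.sub (.sub (.const 1) (.get 2 (.reg 2) (.const 0)))
        (.get 4 (.get 3 (.reg 2) (.const 0)) (.const 0)))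
      deleteVertex .skip)

theorem deleteUnmarked_spec (h : Holds s n k A V T L M)
    (hA : ∀ a b, ¬ (a < n ∧ b < n) → A a b = 0) {D : ℕ → Prop} [DecidablePred D]
    (hD : ∀ a, D a ↔ a < n ∧ T a = 0 ∧ L a ∉ M) :
    Spec deleteUnmarked s ((n + 1) * (12 + (4 + (n + 1) * (8 + 8)) + 8)) fun s' =>
      Holds s' n k (fun a b => if D a ∨ D b then 0 else A a b)
        (fun a => if D a then 0 else V a) T L M := by
  refine (Spec.forLoop (n := n) (fun i s' => s'.reg 2 = i ∧
    Holds s' n k (fun a b => if (a < i ∧ D a) ∨ (b < i ∧ D b) then 0 else A a b)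
      (fun a => if a < i ∧ D a then 0 else V a) T L M) ?_ ?_ ?_).mono le_rfl ?_
  · exact ⟨by simp [Memory.setReg], by simpa using h.setReg (by omega)⟩
  · rintro i s' ⟨h2, h'⟩
    exact ⟨h'.reg0, h2⟩
  · rintro i s' hi ⟨h2, h'⟩
    refine Spec.cond (B' := 4 + (n + 1) * (8 + 8)) (fun he => ?_) (fun he => ?_)
      (by simp [Expr.cost])
    · simp only [Expr.eval, h2, h'.arr2, h'.arr3, h'.arr4] at he
      have hDi : D i := (hD i).2 ⟨hi, by omega, fun hmem => by rw [if_pos hmem] at he; omega⟩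
      refine (deleteVertex_spec h' h2 ?_).mono le_rfl ?_
      · intro a b hab
        simp [hA a b hab]
      rintro s₁ ⟨h2', h₁⟩
      refine ⟨h2', by simp [Memory.setReg], ?_⟩
      have hlt (a : ℕ) : a < i + 1 ∧ D a ↔ a = i ∨ a < i ∧ D a := by
        rcases eq_or_ne a i with rfl | hne
        · simp [hDi]
        · simp [hne, show a < i + 1 ↔ a < i by omega]
      convert h₁.setReg (x := 2) (m := i + 1) le_rfl using 1
      · funext a b
        simp only [hlt, ← ite_or]
        exact if_congr (by tauto) rfl rfl
      · funext a
        simp only [hlt, ← ite_or]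
    · simp only [Expr.eval, h2, h'.arr2, h'.arr3, h'.arr4] at he
      have hDi : ¬ D i := fun hDi => by
        obtain ⟨-, h3, h4⟩ := (hD i).1 hDi
        rw [if_neg h4] at he
        omega
      have hlt (a : ℕ) : a < i + 1 ∧ D a ↔ a < i ∧ D a := by
        rcases eq_or_ne a i with rfl | hne
        · simp [hDi]
        · rw [show a < i + 1 ↔ a < i by omega]
      exact Spec.skip ⟨h2, by simp [Memory.setReg],
        by simpa only [hlt] using h'.setReg (by omega)⟩ (by omega)
  · rintro s' ⟨-, h'⟩
    have hlt (a : ℕ) : a < n ∧ D a ↔ D a := and_iff_right_of_imp fun h => ((hD a).1 h).1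
    simpa only [hlt] using h'

end

/-! ### Instances in memory -/

section
variable {n : ℕ} {G : SimpleGraph (Fin n)} {S : Finset (Fin n)}

theorem vertexCell_eq_ite {i : ℕ} (hi : i < n) :
    vertexCell S i = if (⟨i, hi⟩ : Fin n) ∈ S then 1 else 0 := by
  refine if_congr ⟨?_, fun h => ⟨_, h, rfl⟩⟩ rfl rfl
  rintro ⟨v, hv, rfl⟩
  exact hv

theorem vertexCell_of_le {i : ℕ} (hi : n ≤ i) : vertexCell S i = 0 :=
  if_neg fun ⟨v, _, h⟩ => by omega

open Classical in
theorem adjCell_eq_ite {i j : ℕ} (hi : i < n) (hj : j < n) :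
    adjCell G S i j = if (⟨i, hi⟩ : Fin n) ∈ S ∧ (⟨j, hj⟩ : Fin n) ∈ S ∧ G.Adj ⟨i, hi⟩ ⟨j, hj⟩
      then 1 else 0 := by
  refine if_congr ⟨?_, fun h => ⟨_, h.1, _, h.2.1, rfl, rfl, h.2.2⟩⟩ rfl rfl
  rintro ⟨u, hu, v, hv, rfl, rfl, huv⟩
  exact ⟨hu, hv, huv⟩

theorem adjCell_of_not_lt {i j : ℕ} (h : ¬ (i < n ∧ j < n)) : adjCell G S i j = 0 :=
  if_neg fun ⟨u, _, v, _, hu, hv, _⟩ => by omega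

theorem adjCell_le_one (i j : ℕ) : adjCell G S i j ≤ 1 := by
  unfold adjCell
  split_ifs <;> omega

theorem vertexCell_eq_zero_iff (v : Fin n) : vertexCell S v = 0 ↔ v ∉ S := by
  simp [vertexCell_eq_ite v.2]

theorem adjCell_univ_ne_zero_iff (u v : Fin n) :
    adjCell G Finset.univ u v ≠ 0 ↔ G.Adj u v := by
  simp [adjCell_eq_ite u.2 v.2]

theorem card_filter_vertexCell_le :
    ((Finset.range n).filter (vertexCell S · ≠ 0)).card ≤ S.card := by
  rw [← Finset.card_map Fin.valEmbedding]
  refine Finset.card_le_card fun i hi => ?_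
  obtain ⟨hi, hS⟩ := Finset.mem_filter.1 hi
  rw [Finset.mem_range] at hi
  exact Finset.mem_map.2
    ⟨⟨i, hi⟩, not_not.1 fun h => hS ((vertexCell_eq_zero_iff ⟨i, hi⟩).2 h), rfl⟩

theorem holds_inputMemory (G : SimpleGraph (Fin n)) (k : ℕ) (T : Finset (Fin n)) :
    Holds (inputMemory G k T) n k (adjCell G Finset.univ)
      (vertexCell (Finset.univ : Finset (Fin n))) (vertexCell T) (fun _ => 0) ∅ := by
  constructor <;> simp [inputMemory]

end

/-- The kernelization: compute the components outside the modulator, mark components for all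
vertices of the modulator as well as some of the others, and delete the unmarked ones. -/
def kernelization : Program :=
  .seq initLabels <| .seq mergeEdges <| .seq markNeighbors <|
    .seq (.cond (.reg 8) markLabels .skip) deleteUnmarked

theorem kernelization_spec {n : ℕ} (G : SimpleGraph (Fin n)) (k : ℕ) (T : Finset (Fin n)) :
    Spec kernelization (inputMemory G k T) (300 * (n + 1) ^ 3) fun s' =>
      ∃ (S : Finset (Fin n)) (L : Fin n → ℕ) (M₀ M : Finset ℕ),
        HoldsInstance s' G S k ∧ M₀ ⊆ M ∧ (T = ∅ → M = ∅) ∧ M.card ≤ (T.card + 1) * (k + 3) ∧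
        (∀ u w, u ∉ T → w ∉ T → G.Adj u w → L u = L w) ∧
        (∀ x y, L x = L y → (outside G T).Reachable x y) ∧
        (∀ v, v ∈ S ↔ v ∈ T ∨ L v ∈ M) ∧
        (∀ v ∈ T, Saturated L (fun u => u ∉ T ∧ G.Adj v u) (k + 3) ∅ M₀) ∧
        (T ≠ ∅ → Saturated L (fun u => u ∉ T) (k + 3) M₀ M) := by
  classical
  have hbound : (n + 1) * (4 + 8) +
      ((n + 1) * ((n + 1) * (12 + (8 + (n + 1) * (16 + 8)) + 8) + 8) +
      ((n + 1) * (4 + (2 + (2 + (n + 1) * (37 + 8))) + 8) +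
      ((2 + (2 + (n + 1) * (37 + 8))) + ((n + 1) * (12 + (4 + (n + 1) * (8 + 8)) + 8))))) ≤
      300 * (n + 1) ^ 3 := by
    generalize hm : n + 1 = m
    have hm1 : 1 ≤ m := by omega
    have h1 : 1 ≤ m ^ 3 := Nat.one_le_pow _ _ hm1
    have h2 : m ≤ m ^ 3 := Nat.le_self_pow (by omega) m
    have h3 : m ^ 2 ≤ m ^ 3 := Nat.pow_le_pow_right hm1 (by omega)
    nlinarith
  refine Spec.seq (initLabels_spec (holds_inputMemory G k T)) ?_ hbound
  rintro s₁ ⟨L₁, hL₁, h8, h₁⟩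
  refine Spec.seq (mergeEdges_spec h₁
    (E := fun x y => ∃ hx hy, (outside G T).Adj ⟨x, hx⟩ ⟨y, hy⟩)
    (C := fun x y => ∃ hx hy, (outside G T).Reachable ⟨x, hx⟩ ⟨y, hy⟩) ?_ ?_ ?_ ?_ ?_) ?_ le_rfl
  · intro i hi j hj
    by_cases h1 : (⟨i, hi⟩ : Fin n) ∈ T <;> by_cases h2 : (⟨j, hj⟩ : Fin n) ∈ T <;>
    by_cases h3 : G.Adj ⟨i, hi⟩ ⟨j, hj⟩ <;>
    simp [vertexCell_eq_ite hi, vertexCell_eq_ite hj, adjCell_eq_ite hi hj, h1, h2, h3, hi, hj,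
      outside]
  · rintro i - j - ⟨hi, hj, h⟩
    exact ⟨hi, hj, h.reachable⟩
  · rintro x y ⟨hx, hy, h⟩
    exact ⟨hy, hx, h.symm⟩
  · rintro x y z ⟨hx, _, h⟩ ⟨_, hz, h'⟩
    exact ⟨hx, hz, h.trans h'⟩
  · intro x hx y hy hxy
    rw [hL₁ x hx, hL₁ y hy] at hxy
    subst hxy
    exact ⟨hx, hx, .refl _⟩
  rintro s₂ ⟨h8', L, hLC, hLE, h₂⟩
  refine Spec.seq (markNeighbors_spec h₂ (by rw [h8', h8]; simp [inputMemory])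
    fun i _ u _ => adjCell_le_one i u) ?_ le_rfl
  rintro s₃ ⟨h2, hT0, M₀, hM₀, hM₀8, hT8, hsat, h₃⟩
  have hT8' : T = ∅ ↔ s₃.reg 8 = 0 := by
    constructor
    · rintro rfl
      by_contra hne
      obtain ⟨v, -, hv⟩ := hT8 hne
      exact hv (by simp [vertexCell])
    · refine fun h0 => Finset.eq_empty_of_forall_notMem fun v hv => ?_
      exact (vertexCell_eq_zero_iff v).1 (hT0 h0 v v.2) hv
  refine Spec.seq (B₂ := (n + 1) * (12 + (4 + (n + 1) * (8 + 8)) + 8)) (R := fun s' =>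
    ∃ M, M₀ ⊆ M ∧ (T = ∅ → M = ∅) ∧ M.card ≤ M₀.card + (k + 3) ∧
      (T ≠ ∅ → Saturated (fun u : Fin n => L u) (fun u => u ∉ T) (k + 3) M₀ M) ∧
      Holds s' n k (adjCell G Finset.univ) (vertexCell (Finset.univ : Finset (Fin n)))
        (vertexCell T) L M)
    (Spec.cond (B' := 2 + (n + 1) * (37 + 8)) (fun he => ?_) (fun he => ?_) (by simp [Expr.cost]))
    ?_ le_rfl
  · refine (markLabels_spec h₃ h2 (N := fun u => vertexCell T u = 0) ?_ ?_).mono le_rfl ?_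
    · intro u hu
      -- Row `n` of the matrix is zero, so the summand `n + 1 - n` alone makes everything a
      -- neighbour.
      rw [adjCell_of_not_lt (by omega)]
      omega
    · intro u hu
      exact ⟨fun h => ⟨by omega, h⟩, And.right⟩
    · rintro s₄ ⟨-, -, M, hMM, hM, hsat', h₄⟩
      refine ⟨M, hMM, fun hT => absurd (hT8'.1 hT) he, hM, fun _ => ?_, h₄⟩
      simpa only [vertexCell_eq_zero_iff] using hsat'
  · have hT := hT8'.2 he
    exact Spec.skip ⟨M₀, subset_rfl, fun _ => hM₀8 he, by omega, fun h => absurd hT h, h₃⟩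
      (by omega)
  rintro s₄ ⟨M, hMM, hMT, hM, hsat', h₄⟩
  refine (deleteUnmarked_spec h₄ (fun a b => adjCell_of_not_lt)
    (D := fun a => a < n ∧ vertexCell T a = 0 ∧ L a ∉ M) fun _ => Iff.rfl).mono le_rfl ?_
  intro s₅ h₅
  refine ⟨Finset.univ.filter fun v => v ∈ T ∨ L v ∈ M, fun v => L v, M₀, M,
    ⟨h₅.reg0, h₅.reg1, fun i j => ?_, fun i => ?_⟩, hMM, hMT, ?_, ?_, ?_, by simp, ?_, hsat'⟩
  · rw [h₅.arr0]
    by_cases hij : i < n ∧ j < n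
    · obtain ⟨hi, hj⟩ := hij
      rw [adjCell_eq_ite hi hj, adjCell_eq_ite hi hj, vertexCell_eq_ite hi, vertexCell_eq_ite hj]
      by_cases h1 : (⟨i, hi⟩ : Fin n) ∈ T <;> by_cases h2 : (⟨j, hj⟩ : Fin n) ∈ T <;>
      by_cases h3 : L i ∈ M <;> by_cases h4 : L j ∈ M <;> simp [h1, h2, h3, h4, hi, hj]
    · rw [adjCell_of_not_lt hij, adjCell_of_not_lt hij, ite_self]
  · rw [h₅.arr1]
    by_cases hi : i < n
    · simp only [vertexCell_eq_ite hi]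
      by_cases h1 : (⟨i, hi⟩ : Fin n) ∈ T <;> by_cases h3 : L i ∈ M <;> simp [h1, h3, hi]
    · simp only [vertexCell_of_le (not_lt.1 hi), ite_self]
  · have := Nat.mul_le_mul_right (k + 3) (card_filter_vertexCell_le (S := T))
    rw [add_mul, one_mul]
    omega
  · intro u w hu hw huw
    exact hLE u u.2 w w.2 ⟨u.2, w.2, huw, hu, hw⟩
  · intro x y hxy
    obtain ⟨_, _, h⟩ := hLC x x.2 y y.2 hxy
    exact h
  · intro v hv
    have := hsat v v.2 (by rwa [Ne, vertexCell_eq_zero_iff, not_not])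
    simpa only [vertexCell_eq_zero_iff, adjCell_univ_ne_zero_iff] using this

end PHCAVD

/-! ### Correctness, running time and size of the kernel -/

theorem mainTheorem5 (c : ℕ) :
    ∃ (C : ℕ) (time : Polynomial ℕ) (prog : PHCAVD.Program),
      ∀ (n : ℕ) (G : SimpleGraph (Fin n)) (k : ℕ) (T : Finset (Fin n)),
        PHCAVD.IsNiceModulator c G k T →
        ∃ (t : ℕ) (out : PHCAVD.Memory) (S : Finset (Fin n)) (k' : ℕ),
          PHCAVD.Runs prog (PHCAVD.inputMemory G k T) t out ∧
          t ≤ time.eval (n + Nat.size k) ∧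
          PHCAVD.HoldsInstance out G S k' ∧
          k' ≤ k ∧
          (PHCAVD.IsYesInstance (G.induce {v | v ∈ S}) k' ↔ PHCAVD.IsYesInstance G k) ∧
          PHCAVD.numComponents (G.induce {v | v ∈ S ∧ v ∉ T}) ≤ C * max k 1 * T.card ^ 2 := by
  -- For nonempty `T`, `|T| + 1 ≤ 2 * |T| ^ 2` and `k + 3 ≤ 4 * max k 1`, whence 8.
  refine ⟨8, 300 * (Polynomial.X + 1) ^ 3, PHCAVD.kernelization, fun n G k T hT => ?_⟩
  obtain ⟨t, out, hrun, ht, S, L, M₀, M, hout, hMM, hMT, hM, hL, hconn, hS, hsat, hextra⟩ :=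
    PHCAVD.kernelization_spec G k T
  refine ⟨t, out, S, k, hrun, ht.trans ?_, hout, le_rfl, ?_, ?_⟩
  · simp only [Polynomial.eval_mul, Polynomial.eval_pow, Polynomial.eval_add, Polynomial.eval_X,
      Polynomial.eval_one, Polynomial.eval_ofNat]
    gcongr
    omega
  · rcases eq_or_ne T ∅ with rfl | hne
    -- With `T` empty, `G` is in the class, so both instances are solved by deleting nothing.
    · have hyes : PHCAVD.IsYesInstance G k := ⟨∅, by simp, hT.1⟩
      exact iff_of_true (hyes.induce _) hyes
    · exact PHCAVD.isYesInstance_induce_iff hT.1 hL hMM hS hsat (hextra hne)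
  · refine (PHCAVD.numComponents_le hL hconn hS).trans ?_
    rcases eq_or_ne T ∅ with rfl | hne
    · simp [hMT rfl]
    · have hpos : 1 ≤ T.card := Finset.card_pos.2 (Finset.nonempty_of_ne_empty hne)
      have hk : k + 3 ≤ 4 * max k 1 := by omega
      calc M.card ≤ (T.card + 1) * (k + 3) := hM
        _ ≤ (2 * T.card ^ 2) * (4 * max k 1) := Nat.mul_le_mul (by nlinarith) hk
        _ = 8 * max k 1 * T.card ^ 2 := by ring
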